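/- Let $a>0$, $\Omega_a:=[-a,a]^2$, and let $f\in L^2(\Omega_a)$ be a complex-valued function supported in the closed disk $\mathbb{B}_a:=\{\mathbf{x}\in\mathbb{R}^2:\|\mathbf{x}\|_2\le a\}$ (that is, $f=0$ almost everywhere on $\Omega_a\setminus\mathbb{B}_a$). Let $m\in\mathbb{Z}$ and let $n\ge |m|$ be an integer with $n\equiv |m|\pmod 2$. Define the radial Zernike polynomial \[ Z_{nm}(r):=\sum_{j=0}^{\frac{n-|m|}{2}}(-1)^j\frac{(n-j)!}{j!\left(\frac{n+|m|}{2}-j\right)!\left(\frac{n-|m|}{2}-j\right)!}\,r^{n-2j}, \] the functions \[ V_{nm}^a(r,\theta):=a^{-1}\sqrt{\frac{n+1}{\pi}}\;Z_{nm}(a^{-1}r)\,e^{\mathrm{i}m\theta}, \] and the Fourier–Zernike coefficient \[ C_{n,m}^a(f):=\int_0^a\int_0^{2\pi}f(r\cos\theta,r\sin\theta)\,\overline{V_{nm}^a(r,\theta)}\;r\,d\theta\,dr . \] For $\mathbf{k}=(k_1,k_2)\in\mathbb{Z}^2$ let \[ \widehat{f}(\mathbf{k}):=\int_{-a}^a\int_{-a}^a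 f(x_1,x_2)\,e^{-\pi\mathrm{i}a^{-1}(k_1x_1+k_2x_2)}\,dx_1\,dx_2 , \] let $|\mathbf{k}|:=\sqrt{k_1^2+k_2^2}$, let $\Phi(\mathbf{k})\in[0,2\pi)$ be the polar angle of $\mathbf{k}$, so that $k_1=|\mathbf{k}|\cos\Phi(\mathbf{k})$ and $k_2=|\mathbf{k}|\sin\Phi(\mathbf{k})$ (with $\Phi(\mathbf{0}):=0$), and let \[ c_a(\mathbf{k};n,m):=\sqrt{n+1}\;\frac{\mathrm{i}^m(-1)^{\frac{n-m}{2}}J_{n+1}(\pi|\mathbf{k}|)}{2a\sqrt{\pi}\,|\mathbf{k}|}\;e^{-\mathrm{i}m\Phi(\mathbf{k})}, \] where $J_{n+1}$ is the Bessel function of the first kind of order $n+1$, and where for $\mathbf{k}=\mathbf{0}$ the quotient $J_{n+1}(\pi|\mathbf{k}|)/|\mathbf{k}|$ stands for its limit $\lim_{t\to0^+}J_{n+1}(\pi t)/t$, which is $\pi/2$ if $n=0$ and $0$ if $n\ge1$. Then \[ C_{n,m}^a(f)=\sum_{\mathbf{k}\in\mathbb{Z}^2}c_a(\mathbf{k};n,m)\,\widehat{f}(\mathbf{k}),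 \] where the series converges absolutely. -/

import Mathlib

open MeasureTheory Set Real

noncomputable section

namespace FourierZernike

/-- The Bessel function of the first kind of order `q ∈ ℕ`, by its power series
`J_q(x) = ∑_j (-1)^j / (j! (j+q)!) (x/2)^(2j+q)`. -/
def besselJ (q : ℕ) (x : ℝ) : ℝ :=
  ∑' j : ℕ, (-1 : ℝ) ^ j / ((j.factorial : ℝ) * ((j + q).factorial : ℝ)) * (x / 2) ^ (2 * j + q)

/-- The radial Zernike polynomial `Z_{nm}`, for `n ≥ |m|` with `n - |m|` even (so that no
subtraction or division of natural numbers below is truncated). -/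
def zernikeRadial (n : ℕ) (m : ℤ) (r : ℝ) : ℝ :=
  ∑ j ∈ Finset.range ((n - m.natAbs) / 2 + 1),
    (-1 : ℝ) ^ j * ((n - j).factorial : ℝ) /
      ((j.factorial : ℝ) * (((n + m.natAbs) / 2 - j).factorial : ℝ) *
        (((n - m.natAbs) / 2 - j).factorial : ℝ)) * r ^ (n - 2 * j)

/-- The Fourier–Zernike basis element `V_{nm}^a` in polar form. -/
def zernikeV (a : ℝ) (n : ℕ) (m : ℤ) (r θ : ℝ) : ℂ :=
  ((a⁻¹ * √(((n : ℝ) + 1) / π) * zernikeRadial n m (a⁻¹ * r) : ℝ) : ℂ) *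
    Complex.exp (Complex.I * (m : ℂ) * (θ : ℂ))

/-- The Fourier–Zernike coefficient `C_{n,m}^a(f)`. -/
def zernikeCoeff (a : ℝ) (n : ℕ) (m : ℤ) (f : ℝ × ℝ → ℂ) : ℂ :=
  ∫ r in (0 : ℝ)..a, ∫ θ in (0 : ℝ)..(2 * π),
    f (r * cos θ, r * sin θ) * (starRingEnd ℂ) (zernikeV a n m r θ) * (r : ℂ)

/-- The square `Ω_a = [-a,a]²`. -/
def square (a : ℝ) : Set (ℝ × ℝ) := Icc (-a) a ×ˢ Icc (-a) a

/-- The closed Euclidean disk of radius `a` centred at the origin. -/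
def disk (a : ℝ) : Set (ℝ × ℝ) := {x | √(x.1 ^ 2 + x.2 ^ 2) ≤ a}

/-- The (unnormalized) Fourier coefficient of `f` on the square `[-a,a]²`. -/
def squareFourierCoeff (a : ℝ) (f : ℝ × ℝ → ℂ) (k : ℤ × ℤ) : ℂ :=
  ∫ x₂ in (-a)..a, ∫ x₁ in (-a)..a,
    f (x₁, x₂) * Complex.exp (-((π : ℂ) * Complex.I * (a : ℂ)⁻¹ *
      ((k.1 : ℂ) * (x₁ : ℂ) + (k.2 : ℂ) * (x₂ : ℂ))))

/-- The Euclidean length `|k|`. -/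
def rho (k : ℤ × ℤ) : ℝ := √((k.1 : ℝ) ^ 2 + (k.2 : ℝ) ^ 2)

/-- The polar angle of `k`, normalized to `[0, 2π)`. -/
def phi (k : ℤ × ℤ) : ℝ :=
  toIcoMod Real.two_pi_pos 0 (Complex.arg ((k.1 : ℂ) + (k.2 : ℂ) * Complex.I))

/-- The function `t ↦ J_{n+1}(π t) / t`, extended by its limit at `t = 0`, which is `π / 2` for
`n = 0` and `0` for `n ≥ 1`. -/
def besselQuotient (n : ℕ) (t : ℝ) : ℝ :=
  if t = 0 then (if n = 0 then π / 2 else 0) else besselJ (n + 1) (π * t) / t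

/-- The coefficient `c_a(k; n, m)`. -/
def zernikeKernel (a : ℝ) (k : ℤ × ℤ) (n : ℕ) (m : ℤ) : ℂ :=
  ((√((n : ℝ) + 1) : ℝ) : ℂ) *
    (Complex.I ^ m * (-1 : ℂ) ^ (((n : ℤ) - m) / 2) * ((besselQuotient n (rho k) : ℝ) : ℂ) /
      ((2 * a * √π : ℝ) : ℂ)) *
    Complex.exp (-(Complex.I * (m : ℂ) * ((phi k : ℝ) : ℂ)))

end FourierZernike

end

/-!
Parseval's identity on the square, applied to `f` and to the Zernike function cut off to the disk,
writes `C_{n,m}^a(f)` as an absolutely convergent series in the Fourier coefficients of `f`; the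
multipliers are the conjugate Fourier coefficients of the cut-off Zernike function. In polar
coordinates the angular part of such a coefficient is Bessel's integral for `J_{|m|}`, which leaves
`∫₀¹ Z_{nm}(r) J_{|m|}(π |k| r) r dr`. Expanding `J_{|m|}` in its power series reduces this to the
moments of `Z_{nm}` against `r^{|m| + 2s + 1}`. The defining sum of `Z_{nm}` turns the moment into
the partial fraction expansion of
`s (s - 1) ⋯ (s - M + 1) / (2 (s + |m| + 1) ⋯ (s + |m| + M + 1))`, where `n = |m| + 2M`. The first
`M` moments thus vanish, and what remains of the series is that of `J_{n+1}(π |k|) / (π |k|)`, up to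
the sign `(-1)^M`.
-/

namespace FourierZernike

section PartialFractions

open Polynomial Nat

theorem prod_erase_range_natCast_sub {R : Type*} [CommRing R] (i d : ℕ) :
    ∏ j ∈ (Finset.range (i + d + 1)).erase i, ((j : R) - i) = (-1) ^ i * (i ! * d !) := by
  induction d with
  | zero =>
    rw [add_zero, Finset.range_add_one, Finset.erase_insert Finset.notMem_range_self,
      ← Finset.prod_range_reflect, ← Finset.prod_range_add_one_eq_factorial]
    have hterm : ∀ l ∈ Finset.range i, ((i - 1 - l : ℕ) : R) - i = -((l : R) + 1) := by
      intro l hl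
      rw [Nat.sub_sub, Nat.cast_sub (by have := Finset.mem_range.1 hl; omega)]
      push_cast
      ring
    rw [Finset.prod_congr rfl hterm, Finset.prod_neg, Finset.card_range]
    push_cast
    rw [factorial_zero, cast_one, mul_one]
  | succ d ih =>
    rw [← add_assoc, Finset.range_add_one, Finset.erase_insert_of_ne (by omega),
      Finset.prod_insert (by simp), ih, factorial_succ]
    push_cast
    ring

theorem nodal_range_neg_natCast (R : Type*) [CommRing R] (N : ℕ) :
    Lagrange.nodal (Finset.range N) (fun i => -(i : R)) = ascPochhammer R N := by
  induction N with
  | zero => simp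
  | succ N ih =>
    rw [Finset.range_add_one, Lagrange.nodal_insert_eq_nodal Finset.notMem_range_self, ih,
      ascPochhammer_succ_right, mul_comm, C_neg, sub_neg_eq_add, C_eq_natCast]

theorem nodalWeight_range_neg_natCast {K : Type*} [Field K] {i M : ℕ} (hi : i ≤ M) :
    Lagrange.nodalWeight (Finset.range (M + 1)) (fun j => -(j : K)) i =
      (-1) ^ i / (i ! * (M - i)!) := by
  obtain ⟨d, rfl⟩ := Nat.exists_eq_add_of_le hi
  simp only [Lagrange.nodalWeight, Finset.prod_inv_distrib, neg_sub_neg]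
  rw [prod_erase_range_natCast_sub, Nat.add_sub_cancel_left, mul_inv, ← inv_pow, inv_neg_one,
    div_eq_mul_inv]

theorem eval_div_eval_ascPochhammer {K : Type*} [Field K] [CharZero K] {P : K[X]} {M : ℕ}
    (hP : P.degree < (M + 1 : ℕ)) {x : K} (hx : ∀ i ∈ Finset.range (M + 1), x + i ≠ 0) :
    P.eval x / (ascPochhammer K (M + 1)).eval x =
      ∑ i ∈ Finset.range (M + 1), (-1) ^ i / (i ! * (M - i)!) * (x + i)⁻¹ * P.eval (-(i : K)) := by
  have hinj : Set.InjOn (fun i : ℕ => -(i : K)) (Finset.range (M + 1)) := by simp [Set.InjOn]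
  have hnode : ∀ i ∈ Finset.range (M + 1), x ≠ -(i : K) := fun i hi h => hx i hi (by simp [h])
  have hinterp := Lagrange.eval_interpolate_not_at_node (fun i : ℕ => P.eval (-(i : K))) hnode
  rw [← Lagrange.eq_interpolate hinj (by simpa using hP), nodal_range_neg_natCast] at hinterp
  have hne : (ascPochhammer K (M + 1)).eval x ≠ 0 := by
    rw [← nodal_range_neg_natCast]
    exact Lagrange.eval_nodal_not_at_node hnode
  rw [hinterp, mul_div_cancel_left₀ _ hne]
  refine Finset.sum_congr rfl fun i hi => ?_
  rw [nodalWeight_range_neg_natCast (Nat.lt_succ_iff.1 (Finset.mem_range.1 hi)), sub_neg_eq_add]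

end PartialFractions

section Moments

open Polynomial Nat

variable {n M : ℕ} {m : ℤ}

theorem descFactorial_div_ascFactorial_eq_sum (μ M s : ℕ) :
    (s.descFactorial M : ℝ) / (s + μ + 1).ascFactorial (M + 1) =
      ∑ i ∈ Finset.range (M + 1), (-1) ^ (M - i) *
        ((μ + i + 1).ascFactorial M / (i ! * (M - i)!)) * (s + μ + 1 + i : ℝ)⁻¹ := by
  set P : ℝ[X] := (descPochhammer ℝ M).comp (X - C (μ + 1 : ℝ)) with hP
  have hdeg : P.degree < (M + 1 : ℕ) := by
    refine degree_le_natDegree.trans_lt ?_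
    rw [natDegree_comp, descPochhammer_natDegree, natDegree_X_sub_C, mul_one]
    exact_mod_cast Nat.lt_succ_self M
  have hx : ∀ i ∈ Finset.range (M + 1), ((s + μ + 1 : ℕ) : ℝ) + i ≠ 0 := fun i _ => by positivity
  have hs : P.eval ((s + μ + 1 : ℕ) : ℝ) = s.descFactorial M := by
    rw [hP, eval_comp, ← descPochhammer_eval_eq_descFactorial]
    simp [add_assoc]
  have hneg : ∀ i : ℕ, P.eval (-(i : ℝ)) = (-1) ^ M * (μ + i + 1).ascFactorial M := by
    intro i
    have hreflect := ascPochhammer_eval_neg_eq_descPochhammer ℝ (-((μ + i + 1 : ℕ) : ℝ)) M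
    rw [neg_neg, ascPochhammer_nat_eq_natCast_ascFactorial] at hreflect
    rw [hreflect, ← mul_assoc, ← mul_pow, neg_one_mul, neg_neg, one_pow, one_mul, hP, eval_comp]
    congr 1
    rw [eval_sub, eval_X, eval_C]
    push_cast
    ring
  rw [← hs, ← ascPochhammer_nat_eq_natCast_ascFactorial, eval_div_eval_ascPochhammer hdeg hx]
  refine Finset.sum_congr rfl fun i hi => ?_
  have hsign : (-1 : ℝ) ^ i * (-1) ^ M = (-1) ^ (M - i) := by
    rw [← pow_sub_mul_pow (-1 : ℝ) (Nat.lt_succ_iff.1 (Finset.mem_range.1 hi)), mul_left_comm,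
      ← mul_pow]
    simp
  rw [hneg, ← hsign]
  push_cast
  ring

theorem zernikeRadial_eq_sum (hn : n = m.natAbs + 2 * M) (r : ℝ) :
    zernikeRadial n m r = ∑ i ∈ Finset.range (M + 1), (-1) ^ (M - i) *
      ((m.natAbs + i + 1).ascFactorial M / (i ! * (M - i)!)) * r ^ (m.natAbs + 2 * i) := by
  subst hn
  rw [zernikeRadial, ← Finset.sum_range_reflect]
  refine Finset.sum_congr (by congr 2; omega) fun i hi => ?_
  obtain ⟨j, rfl⟩ := Nat.exists_eq_add_of_le (Nat.lt_succ_iff.1 (Finset.mem_range.1 hi))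
  have hfact : ((m.natAbs + i)! * (m.natAbs + i + 1).ascFactorial (i + j) : ℝ) =
      (m.natAbs + i + (i + j))! := mod_cast factorial_mul_ascFactorial _ _
  rw [show (m.natAbs + 2 * (i + j) - m.natAbs) / 2 + 1 - 1 - i = j by omega,
    show m.natAbs + 2 * (i + j) - j = m.natAbs + i + (i + j) by omega,
    show (m.natAbs + 2 * (i + j) + m.natAbs) / 2 - j = m.natAbs + i by omega,
    show (m.natAbs + 2 * (i + j) - m.natAbs) / 2 - j = i by omega,
    show m.natAbs + 2 * (i + j) - 2 * j = m.natAbs + 2 * i by omega,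
    Nat.add_sub_cancel_left, ← hfact]
  field_simp

theorem continuous_zernikeRadial (n : ℕ) (m : ℤ) : Continuous (zernikeRadial n m) := by
  unfold zernikeRadial
  fun_prop

theorem integral_zernikeRadial_mul_pow (hn : n = m.natAbs + 2 * M) (s : ℕ) :
    ∫ r in (0 : ℝ)..1, zernikeRadial n m r * r ^ (m.natAbs + 2 * s + 1) =
      s.descFactorial M / (2 * (s + m.natAbs + 1).ascFactorial (M + 1)) := by
  simp only [zernikeRadial_eq_sum hn, Finset.sum_mul]
  rw [intervalIntegral.integral_finsetSum
    fun i _ => Continuous.intervalIntegrable (by fun_prop) _ _, mul_comm (2 : ℝ), ← div_div,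
    descFactorial_div_ascFactorial_eq_sum, Finset.sum_div]
  refine Finset.sum_congr rfl fun i _ => ?_
  simp only [mul_assoc, ← pow_add, intervalIntegral.integral_const_mul, integral_pow]
  rw [one_pow, zero_pow (by omega)]
  push_cast
  field_simp
  ring

end Moments

section Bessel

open Nat

theorem hasSum_intervalIntegral_of_norm_le {ι E : Type*} [Countable ι] [NormedAddCommGroup E]
    [NormedSpace ℝ E] {F : ι → ℝ → E} {f : ℝ → E} {u : ι → ℝ} {a b : ℝ}
    (hF : ∀ i, Continuous (F i)) (hu : Summable u) (hFu : ∀ i, ∀ x ∈ uIoc a b, ‖F i x‖ ≤ u i)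
    (hf : ∀ x ∈ uIoc a b, HasSum (F · x) (f x)) :
    HasSum (fun i => ∫ x in a..b, F i x) (∫ x in a..b, f x) :=
  intervalIntegral.hasSum_integral_of_dominated_convergence (fun i _ => u i)
    (fun i => (hF i).aestronglyMeasurable) (fun i => .of_forall (hFu i))
    (.of_forall fun _ _ => hu) intervalIntegrable_const (.of_forall hf)

theorem summable_besselJ (q : ℕ) (x : ℝ) :
    Summable fun j : ℕ => (-1 : ℝ) ^ j / (j ! * (j + q)!) * (x / 2) ^ (2 * j + q) := by
  refine .of_norm_bounded ((summable_pow_div_factorial ((x / 2) ^ 2)).mul_left (|x / 2| ^ q))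
    fun j => ?_
  have hfact : (1 : ℝ) ≤ (j + q)! := mod_cast Nat.one_le_iff_ne_zero.2 (factorial_ne_zero _)
  rw [norm_mul, norm_div, norm_pow, norm_neg, norm_one, one_pow, norm_pow, pow_add, pow_mul,
    Real.norm_eq_abs (x / 2), sq_abs, Real.norm_of_nonneg (by positivity)]
  calc 1 / (j ! * (j + q)! : ℝ) * (((x / 2) ^ 2) ^ j * |x / 2| ^ q)
      ≤ 1 / (j ! * 1) * (((x / 2) ^ 2) ^ j * |x / 2| ^ q) := by gcongr
    _ = |x / 2| ^ q * (((x / 2) ^ 2) ^ j / j !) := by ring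

theorem hasSum_besselJ (q : ℕ) (x : ℝ) :
    HasSum (fun j : ℕ => (-1 : ℝ) ^ j / (j ! * (j + q)!) * (x / 2) ^ (2 * j + q)) (besselJ q x) :=
  (summable_besselJ q x).hasSum

theorem besselQuotient_eq_tsum (n : ℕ) (t : ℝ) :
    besselQuotient n t = π / 2 *
      ∑' l : ℕ, (-1 : ℝ) ^ l / (l ! * (l + (n + 1))!) * (π * t / 2) ^ (2 * l + n) := by
  unfold besselQuotient
  split_ifs with ht hn
  · subst ht hn
    rw [tsum_eq_single 0 fun l hl => by simp [hl]]
    simp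
  · subst ht
    simp [hn]
  · rw [besselJ, ← tsum_mul_left, ← tsum_div_const]
    refine tsum_congr fun l => ?_
    rw [← add_assoc (2 * l) n 1, pow_succ (π * t / 2)]
    field_simp

theorem integral_exp_I_mul_int (l : ℤ) :
    ∫ θ in (0 : ℝ)..(2 * π), Complex.exp (Complex.I * l * θ) =
      if l = 0 then 2 * (π : ℂ) else 0 := by
  split_ifs with hl
  · simp [hl]
  · have hne : Complex.I * (l : ℂ) ≠ 0 := mul_ne_zero Complex.I_ne_zero (mod_cast hl)
    have hexp : Complex.I * (l : ℂ) * ((2 * π : ℝ) : ℂ) = l * (2 * π * Complex.I) := by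
      push_cast; ring
    rw [integral_exp_mul_complex hne, hexp, Complex.exp_int_mul_two_pi_mul_I]
    simp

theorem integral_two_mul_cos_pow_mul_exp (p : ℕ) (m : ℤ) :
    ∫ θ in (0 : ℝ)..(2 * π), ((2 * cos θ : ℝ) : ℂ) ^ p * Complex.exp (-(Complex.I * m * θ)) =
      ∑ j ∈ Finset.range (p + 1),
        if 2 * (j : ℤ) - p - m = 0 then p.choose j * (2 * π : ℂ) else 0 := by
  have hexpand : ∀ θ : ℝ, ((2 * cos θ : ℝ) : ℂ) ^ p * Complex.exp (-(Complex.I * m * θ)) =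
      ∑ j ∈ Finset.range (p + 1), (p.choose j : ℂ) *
        Complex.exp (Complex.I * ((2 * (j : ℤ) - p - m : ℤ) : ℂ) * θ) := by
    intro θ
    have htwo_cos : ((2 * cos θ : ℝ) : ℂ) =
        Complex.exp (θ * Complex.I) + Complex.exp (-θ * Complex.I) := by
      rw [Complex.ofReal_mul, Complex.ofReal_cos, Complex.ofReal_ofNat, Complex.two_cos]
    rw [htwo_cos, add_pow, Finset.sum_mul]
    refine Finset.sum_congr rfl fun j hj => ?_
    rw [← Complex.exp_nat_mul, ← Complex.exp_nat_mul, mul_comm _ (p.choose j : ℂ), mul_assoc,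
      ← Complex.exp_add, ← Complex.exp_add]
    congr 2
    push_cast [Nat.cast_sub (Nat.lt_succ_iff.1 (Finset.mem_range.1 hj))]
    ring
  simp_rw [hexpand]
  rw [intervalIntegral.integral_finsetSum
    fun j _ => Continuous.intervalIntegrable (by fun_prop) _ _]
  refine Finset.sum_congr rfl fun j _ => ?_
  rw [intervalIntegral.integral_const_mul, integral_exp_I_mul_int, mul_ite, mul_zero]

theorem integral_two_mul_cos_pow_natAbs_add_mul_exp (s : ℕ) (m : ℤ) :
    ∫ θ in (0 : ℝ)..(2 * π), ((2 * cos θ : ℝ) : ℂ) ^ (m.natAbs + 2 * s) *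
        Complex.exp (-(Complex.I * m * θ)) = (m.natAbs + 2 * s).choose s * (2 * π : ℂ) := by
  rw [integral_two_mul_cos_pow_mul_exp]
  rcases le_total 0 m with hm | hm
  · rw [Finset.sum_eq_single_of_mem (m.natAbs + s) (Finset.mem_range.2 (by omega))
      fun j _ hj => if_neg (by omega), if_pos (by omega),
      Nat.choose_symm_of_eq_add (by omega : m.natAbs + 2 * s = (m.natAbs + s) + s)]
  · rw [Finset.sum_eq_single_of_mem s (Finset.mem_range.2 (by omega))
      fun j _ hj => if_neg (by omega), if_pos (by omega)]

theorem integral_two_mul_cos_pow_mul_exp_eq_zero {p : ℕ} {m : ℤ}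
    (hp : ∀ s, p ≠ m.natAbs + 2 * s) :
    ∫ θ in (0 : ℝ)..(2 * π), ((2 * cos θ : ℝ) : ℂ) ^ p * Complex.exp (-(Complex.I * m * θ)) =
      0 := by
  rw [integral_two_mul_cos_pow_mul_exp]
  refine Finset.sum_eq_zero fun j hj => if_neg fun hjm => ?_
  have hjp := Finset.mem_range.1 hj
  rcases le_total 0 m with hm | hm
  · exact hp (p - j) (by omega)
  · exact hp j (by omega)

theorem norm_exp_neg_I_mul (x y : ℝ) : ‖Complex.exp (-(Complex.I * x * y))‖ = 1 := by
  rw [show -(Complex.I * x * y) = ((-(x * y) : ℝ) : ℂ) * Complex.I by push_cast; ring,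
    Complex.norm_exp_ofReal_mul_I]

theorem hasSum_integral_exp_I_mul_cos (m : ℤ) (z : ℝ) :
    HasSum (fun p : ℕ => (Complex.I * z / 2) ^ p / p ! *
        ∫ θ in (0 : ℝ)..(2 * π), ((2 * cos θ : ℝ) : ℂ) ^ p * Complex.exp (-(Complex.I * m * θ)))
      (∫ θ in (0 : ℝ)..(2 * π),
        Complex.exp (Complex.I * z * cos θ) * Complex.exp (-(Complex.I * m * θ))) := by
  simp_rw [← intervalIntegral.integral_const_mul]
  refine hasSum_intervalIntegral_of_norm_le (u := fun p => |z| ^ p / p !)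
    (fun p => by fun_prop) (summable_pow_div_factorial _) (fun p θ _ => ?_) fun θ _ => ?_
  · rw [norm_mul, norm_mul, norm_div, norm_pow, norm_pow, norm_div, norm_mul, Complex.norm_I,
      ← Complex.ofReal_intCast, norm_exp_neg_I_mul, Complex.norm_real, Complex.norm_real,
      Complex.norm_natCast, Complex.norm_ofNat, norm_mul, Real.norm_ofNat]
    calc (1 * ‖z‖ / 2) ^ p / p ! * ((2 * ‖cos θ‖) ^ p * 1) = ‖z‖ ^ p / p ! * ‖cos θ‖ ^ p := by
          rw [mul_pow, div_pow]; field_simp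
      _ ≤ ‖z‖ ^ p / p ! * 1 := by gcongr; exact pow_le_one₀ (norm_nonneg _) (abs_cos_le_one θ)
      _ = |z| ^ p / p ! := by rw [mul_one, Real.norm_eq_abs]
  · rw [Complex.exp_eq_exp_ℂ]
    refine ((NormedSpace.expSeries_div_hasSum_exp (Complex.I * z * cos θ)).mul_right _).congr_fun
      fun p => ?_
    rw [← mul_assoc, div_mul_eq_mul_div, ← mul_pow]
    push_cast
    ring_nf

theorem integral_exp_I_mul_cos_eq_besselJ (m : ℤ) (z : ℝ) :
    ∫ θ in (0 : ℝ)..(2 * π),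
        Complex.exp (Complex.I * z * cos θ) * Complex.exp (-(Complex.I * m * θ)) =
      2 * π * Complex.I ^ m.natAbs * besselJ m.natAbs z := by
  have hpow := hasSum_integral_exp_I_mul_cos m z
  have hinj : Function.Injective fun s : ℕ => m.natAbs + 2 * s := fun s t hst => by
    simpa using hst
  rw [← hinj.hasSum_iff fun p hp => by
    rw [integral_two_mul_cos_pow_mul_exp_eq_zero fun s hs => hp ⟨s, hs.symm⟩, mul_zero]] at hpow
  refine hpow.unique (((Complex.hasSum_ofReal.2 (hasSum_besselJ m.natAbs z)).mul_left
    (2 * π * Complex.I ^ m.natAbs)).congr_fun fun s => ?_)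
  have hchoose : ((m.natAbs + 2 * s).choose s : ℂ) =
      (m.natAbs + 2 * s)! / (s ! * (s + m.natAbs)!) := by
    rw [Nat.cast_choose ℂ (by omega), show m.natAbs + 2 * s - s = s + m.natAbs by omega]
  have hfact : ((m.natAbs + 2 * s)! : ℂ) ≠ 0 := mod_cast factorial_ne_zero _
  have hI : Complex.I ^ (m.natAbs + 2 * s) = Complex.I ^ m.natAbs * (-1) ^ s := by
    rw [pow_add, pow_mul, Complex.I_sq]
  rw [Function.comp_apply, integral_two_mul_cos_pow_natAbs_add_mul_exp, hchoose, mul_div_assoc,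
    mul_pow, hI, add_comm (2 * s)]
  push_cast
  field_simp

theorem integral_exp_I_mul_cos_sub_eq_besselJ (m : ℤ) (z Φ : ℝ) :
    ∫ θ in (0 : ℝ)..(2 * π),
        Complex.exp (Complex.I * z * cos (θ - Φ)) * Complex.exp (-(Complex.I * m * θ)) =
      2 * π * Complex.I ^ m.natAbs * besselJ m.natAbs z * Complex.exp (-(Complex.I * m * Φ)) := by
  set F : ℝ → ℂ := fun θ =>
    Complex.exp (Complex.I * z * cos θ) * Complex.exp (-(Complex.I * m * θ)) with hF
  have hperiodic : Function.Periodic F (2 * π) := by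
    intro θ
    have hexp : -(Complex.I * m * ((θ + 2 * π : ℝ) : ℂ)) =
        -(Complex.I * m * θ) - m * (2 * π * Complex.I) := by push_cast; ring
    simp only [hF, cos_add_two_pi]
    rw [hexp, Complex.exp_sub, Complex.exp_int_mul_two_pi_mul_I, div_one]
  have hshift : ∀ θ : ℝ, Complex.exp (Complex.I * z * cos (θ - Φ)) *
      Complex.exp (-(Complex.I * m * θ)) = F (θ - Φ) * Complex.exp (-(Complex.I * m * Φ)) := by
    intro θ
    simp only [hF, mul_assoc, ← Complex.exp_add]
    congr 1
    push_cast
    ring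
  simp_rw [hshift]
  rw [intervalIntegral.integral_mul_const, intervalIntegral.integral_comp_sub_right,
    show 2 * π - Φ = 0 - Φ + 2 * π by ring, hperiodic.intervalIntegral_add_eq _ 0, zero_add,
    integral_exp_I_mul_cos_eq_besselJ]

variable {n M : ℕ} {m : ℤ}

theorem hasSum_integral_zernikeRadial_mul_besselJ (n : ℕ) (m : ℤ) (t : ℝ) :
    HasSum (fun s : ℕ => (-1 : ℝ) ^ s / (s ! * (s + m.natAbs)!) * (t / 2) ^ (2 * s + m.natAbs) *
        ∫ r in (0 : ℝ)..1, zernikeRadial n m r * r ^ (m.natAbs + 2 * s + 1))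
      (∫ r in (0 : ℝ)..1, zernikeRadial n m r * besselJ m.natAbs (t * r) * r) := by
  have hcont := continuous_zernikeRadial n m
  obtain ⟨B, hB⟩ := (isCompact_Icc (a := (0 : ℝ)) (b := 1)).exists_bound_of_continuousOn
    hcont.continuousOn
  simp_rw [← intervalIntegral.integral_const_mul]
  refine hasSum_intervalIntegral_of_norm_le (fun s => by fun_prop)
    ((summable_besselJ m.natAbs t).norm.mul_right B) (fun s r hr => ?_) fun r _ => ?_
  · rw [uIoc_of_le zero_le_one] at hr
    rw [norm_mul, norm_mul (zernikeRadial n m r), norm_pow, Real.norm_of_nonneg hr.1.le]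
    gcongr
    exact (mul_le_of_le_one_right (norm_nonneg _) (pow_le_one₀ hr.1.le hr.2)).trans
      (hB r (Ioc_subset_Icc_self hr))
  · refine (((hasSum_besselJ m.natAbs (t * r)).mul_left (zernikeRadial n m r)).mul_right
      r).congr_fun fun s => ?_
    rw [mul_div_right_comm, mul_pow]
    ring

theorem integral_zernikeRadial_mul_besselJ (hn : n = m.natAbs + 2 * M) (ρ : ℝ) :
    ∫ r in (0 : ℝ)..1, zernikeRadial n m r * besselJ m.natAbs (π * ρ * r) * r =
      (-1) ^ M / π * besselQuotient n ρ := by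
  have hsum := hasSum_integral_zernikeRadial_mul_besselJ n m (π * ρ)
  simp_rw [integral_zernikeRadial_mul_pow hn] at hsum
  rw [← (add_right_injective M).hasSum_iff fun s hs => by
    have hsM : s < M := by
      by_contra hle
      exact hs ⟨s - M, by simp only; omega⟩
    simp [Nat.descFactorial_eq_zero_iff_lt.2 hsM]] at hsum
  rw [← hsum.tsum_eq, besselQuotient_eq_tsum, ← mul_assoc, ← tsum_mul_left]
  refine tsum_congr fun l => ?_
  have hdesc : (l ! * (M + l).descFactorial M : ℝ) = (M + l)! := by
    have := Nat.factorial_mul_descFactorial (Nat.le_add_right M l)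
    rw [Nat.add_sub_cancel_left] at this
    exact_mod_cast this
  have hasc : ((M + l + m.natAbs)! * (M + l + m.natAbs + 1).ascFactorial (M + 1) : ℝ) =
      (l + (n + 1))! := by
    rw [show l + (n + 1) = M + l + m.natAbs + (M + 1) by omega]
    exact_mod_cast Nat.factorial_mul_ascFactorial _ _
  rw [Function.comp_apply, show 2 * (M + l) + m.natAbs = 2 * l + n by omega, ← hdesc, ← hasc,
    pow_add]
  field_simp

end Bessel

section Polar

theorem measurableSet_disk (a : ℝ) : MeasurableSet (disk a) :=
  measurableSet_le (by fun_prop) measurable_const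

theorem isCompact_square (a : ℝ) : IsCompact (square a) :=
  isCompact_Icc.prod isCompact_Icc

theorem measurableSet_square (a : ℝ) : MeasurableSet (square a) :=
  measurableSet_Icc.prod measurableSet_Icc

theorem disk_subset_square (a : ℝ) : disk a ⊆ square a := fun x hx =>
  ⟨abs_le.1 ((abs_le_sqrt (le_add_of_nonneg_right (sq_nonneg x.2))).trans hx),
    abs_le.1 ((abs_le_sqrt (le_add_of_nonneg_left (sq_nonneg x.1))).trans hx)⟩

theorem sqrt_sq_mul_cos_add_sq_mul_sin {r : ℝ} (hr : 0 ≤ r) (θ : ℝ) :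
    √((r * cos θ) ^ 2 + (r * sin θ) ^ 2) = r := by
  rw [mul_pow, mul_pow, ← mul_add, cos_sq_add_sin_sq, mul_one, sqrt_sq hr]

theorem polar_mem_disk_iff {a r : ℝ} (hr : 0 ≤ r) (θ : ℝ) :
    (r * cos θ, r * sin θ) ∈ disk a ↔ r ≤ a := by
  rw [disk, mem_ofPred_eq, sqrt_sq_mul_cos_add_sq_mul_sin hr]

variable {E : Type*} [NormedAddCommGroup E] [NormedSpace ℝ E]

theorem integrableOn_polarCoord_target {h : ℝ × ℝ → E} (hh : Integrable h) :
    IntegrableOn (fun p : ℝ × ℝ => p.1 • h (polarCoord.symm p)) polarCoord.target := by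
  have htarget : MeasurableSet polarCoord.target := polarCoord.open_target.measurableSet
  refine ((integrableOn_image_iff_integrableOn_abs_det_fderiv_smul volume htarget
    (fun p _ => (hasFDerivAt_polarCoord_symm p).hasFDerivWithinAt) polarCoord.symm.injOn h).1
    hh.integrableOn).congr_fun (fun p hp => ?_) htarget
  simp only [det_fderivPolarCoordSymm, abs_of_pos (show 0 < p.1 from hp.1)]

theorem integral_eq_integral_polar {h : ℝ × ℝ → E} (hh : Integrable h) :
    ∫ x, h x = ∫ r in Ioi (0 : ℝ), ∫ θ in (0 : ℝ)..(2 * π), r • h (r * cos θ, r * sin θ) := by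
  have hint := integrableOn_polarCoord_target hh
  rw [← integral_comp_polarCoord_symm]
  rw [show polarCoord.target = Ioi (0 : ℝ) ×ˢ Ioo (-π) π from rfl, Measure.volume_eq_prod]
    at hint ⊢
  rw [setIntegral_prod _ hint]
  refine setIntegral_congr_fun measurableSet_Ioi fun r _ => ?_
  have hperiodic : Function.Periodic (fun θ : ℝ => r • h (r * cos θ, r * sin θ)) (2 * π) :=
    fun θ => by simp only [cos_add_two_pi, sin_add_two_pi]
  simp only [polarCoord_symm_apply]
  rw [← integral_Ioc_eq_integral_Ioo, ← intervalIntegral.integral_of_le (by linarith [pi_pos])]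
  calc ∫ θ in (-π)..π, r • h (r * cos θ, r * sin θ)
      = ∫ θ in (-π)..(-π + 2 * π), r • h (r * cos θ, r * sin θ) := by ring_nf
    _ = ∫ θ in (0 : ℝ)..(2 * π), r • h (r * cos θ, r * sin θ) := by
      rw [hperiodic.intervalIntegral_add_eq _ 0, zero_add]

theorem setIntegral_disk_eq_integral_polar {a : ℝ} (ha : 0 ≤ a) {h : ℝ × ℝ → E}
    (hh : IntegrableOn h (disk a)) :
    ∫ x in disk a, h x =
      ∫ r in (0 : ℝ)..a, ∫ θ in (0 : ℝ)..(2 * π), r • h (r * cos θ, r * sin θ) := by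
  have hI : Integrable ((disk a).indicator h) :=
    (integrable_indicator_iff (measurableSet_disk a)).2 hh
  have houtside : ∀ r ∈ Ioi (0 : ℝ) \ Ioc 0 a,
      ∫ θ in (0 : ℝ)..(2 * π), r • (disk a).indicator h (r * cos θ, r * sin θ) = 0 := by
    intro r ⟨hr0, hra⟩
    simp only [indicator_of_notMem (mt (polar_mem_disk_iff (le_of_lt hr0) _).1
      fun hle => hra ⟨hr0, hle⟩), smul_zero, intervalIntegral.integral_zero]
  rw [← integral_indicator (measurableSet_disk a), integral_eq_integral_polar hI,
    intervalIntegral.integral_of_le ha,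
    setIntegral_eq_of_subset_of_forall_sdiff_eq_zero measurableSet_Ioi Ioc_subset_Ioi_self houtside]
  refine setIntegral_congr_fun measurableSet_Ioc fun r hr => ?_
  simp only [indicator_of_mem ((polar_mem_disk_iff hr.1.le _).2 hr.2)]

end Polar

section ZernikeDisk

/-- The Fourier–Zernike basis element as a function on the plane, extended by zero outside the
disk. Polar angles are taken in `(-π, π]`, and the origin has polar angle `0`. -/
noncomputable def zernikeDisk (a : ℝ) (n : ℕ) (m : ℤ) : ℝ × ℝ → ℂ :=
  (disk a).indicator fun x => zernikeV a n m (polarCoord x).1 (polarCoord x).2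

theorem periodic_zernikeV (a : ℝ) (n : ℕ) (m : ℤ) (r : ℝ) :
    Function.Periodic (zernikeV a n m r) (2 * π) := by
  intro θ
  rw [zernikeV, zernikeV, show Complex.I * m * ((θ + 2 * π : ℝ) : ℂ) =
    Complex.I * m * θ + m * (2 * π * Complex.I) by push_cast; ring, Complex.exp_add,
    Complex.exp_int_mul_two_pi_mul_I, mul_one]

theorem zernikeDisk_polar {a r : ℝ} (hr : 0 < r) (hra : r ≤ a) (n : ℕ) (m : ℤ) (θ : ℝ) :
    zernikeDisk a n m (r * cos θ, r * sin θ) = zernikeV a n m r θ := by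
  have hangle : Complex.arg (Complex.equivRealProd.symm (r * cos θ, r * sin θ)) =
      toIocMod two_pi_pos (-π) θ := by
    rw [← Complex.arg_mul_cos_add_sin_mul_I_eq_toIocMod hr, Complex.equivRealProd_symm_apply]
    push_cast
    ring_nf
  rw [zernikeDisk, indicator_of_mem ((polar_mem_disk_iff hr.le θ).2 hra), polarCoord_apply,
    sqrt_sq_mul_cos_add_sq_mul_sin hr.le, hangle, toIocMod,
    (periodic_zernikeV a n m r).sub_zsmul_eq]

theorem norm_zernikeV (a : ℝ) (n : ℕ) (m : ℤ) (r θ : ℝ) :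
    ‖zernikeV a n m r θ‖ = |a⁻¹ * √((n + 1) / π) * zernikeRadial n m (a⁻¹ * r)| := by
  rw [zernikeV, norm_mul, Complex.norm_real, Real.norm_eq_abs,
    show Complex.I * m * (θ : ℂ) = ((m * θ : ℝ) : ℂ) * Complex.I by push_cast; ring,
    Complex.norm_exp_ofReal_mul_I, mul_one]

theorem measurable_zernikeDisk (a : ℝ) (n : ℕ) (m : ℤ) : Measurable (zernikeDisk a n m) := by
  have hcont := continuous_zernikeRadial n m
  have harg : Measurable fun x : ℝ × ℝ => (polarCoord x).2 :=
    Complex.measurable_arg.comp Complex.equivRealProdCLM.symm.continuous.measurable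
  refine Measurable.indicator ?_ (measurableSet_disk a)
  unfold zernikeV
  simp only [polarCoord_apply] at harg ⊢
  fun_prop

theorem exists_norm_zernikeDisk_le (a : ℝ) (n : ℕ) (m : ℤ) :
    ∃ C, ∀ x, ‖zernikeDisk a n m x‖ ≤ C := by
  have hcont : Continuous fun r => a⁻¹ * √((n + 1) / π) * zernikeRadial n m (a⁻¹ * r) := by
    have := continuous_zernikeRadial n m
    fun_prop
  obtain ⟨C, hC⟩ := (isCompact_Icc (a := (0 : ℝ)) (b := a)).exists_bound_of_continuousOn
    hcont.continuousOn
  refine ⟨max C 0, fun x => ?_⟩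
  by_cases hx : x ∈ disk a
  · rw [zernikeDisk, indicator_of_mem hx, norm_zernikeV]
    exact (hC _ ⟨sqrt_nonneg _, hx⟩).trans (le_max_left _ _)
  · rw [zernikeDisk, indicator_of_notMem hx, norm_zero]
    exact le_max_right _ _

instance isFiniteMeasure_restrict_square (a : ℝ) :
    IsFiniteMeasure (volume.restrict (square a)) :=
  isFiniteMeasure_restrict.2 (isCompact_square a).measure_lt_top.ne

theorem memLp_zernikeDisk (a : ℝ) (n : ℕ) (m : ℤ) (p : ENNReal) :
    MemLp (zernikeDisk a n m) p (volume.restrict (square a)) :=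
  have ⟨C, hC⟩ := exists_norm_zernikeDisk_le a n m
  .of_bound (measurable_zernikeDisk a n m).aestronglyMeasurable C (.of_forall hC)

end ZernikeDisk

section Parseval

open scoped ComplexConjugate

-- Mathlib states Fourier theory on `UnitAddTorus` for these instances, which are not global.
noncomputable local instance : MeasureSpace UnitAddCircle := ⟨AddCircle.haarAddCircle⟩

local instance : Measure.IsAddHaarMeasure (volume : Measure UnitAddCircle) :=
  inferInstanceAs (Measure.IsAddHaarMeasure AddCircle.haarAddCircle)

local instance : IsProbabilityMeasure (volume : Measure UnitAddCircle) :=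
  inferInstanceAs (IsProbabilityMeasure AddCircle.haarAddCircle)

/-- The parametrization of the interval `(-a, a]` by the circle `ℝ / ℤ`, inverse to
`x ↦ x / (2 * a)`. -/
noncomputable def circleToIoc (a : ℝ) (y : UnitAddCircle) : ℝ :=
  2 * a * AddCircle.equivIoc 1 (-(1 / 2)) y

/-- The parametrization of the square `(-a, a]²` by the torus, inverse to `x ↦ x / (2 * a)`. -/
noncomputable def torusToSquare (a : ℝ) (y : UnitAddTorus (Fin 2)) : ℝ × ℝ :=
  (circleToIoc a (y 0), circleToIoc a (y 1))

/-- The exponential whose integral against `f` over the square is the Fourier coefficient of `f`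
at `k`. -/
noncomputable def squareChar (a : ℝ) (k : ℤ × ℤ) (x : ℝ × ℝ) : ℂ :=
  Complex.exp (-(π * Complex.I * (a : ℂ)⁻¹ * (k.1 * x.1 + k.2 * x.2)))

theorem continuous_squareChar (a : ℝ) (k : ℤ × ℤ) : Continuous (squareChar a k) := by
  unfold squareChar
  fun_prop

theorem norm_squareChar (a : ℝ) (k : ℤ × ℤ) (x : ℝ × ℝ) : ‖squareChar a k x‖ = 1 := by
  rw [squareChar, show -(π * Complex.I * (a : ℂ)⁻¹ * (k.1 * x.1 + k.2 * x.2)) =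
    ((-(π * a⁻¹ * (k.1 * x.1 + k.2 * x.2)) : ℝ) : ℂ) * Complex.I by push_cast; ring,
    Complex.norm_exp_ofReal_mul_I]

variable {a : ℝ} {f g : ℝ × ℝ → ℂ}

theorem integrableOn_mul_squareChar (hf : IntegrableOn f (square a)) (k : ℤ × ℤ) :
    IntegrableOn (fun x => f x * squareChar a k x) (square a) :=
  hf.mul_bdd (continuous_squareChar a k).aestronglyMeasurable
    (.of_forall fun x => (norm_squareChar a k x).le)

theorem squareFourierCoeff_eq_setIntegral (ha : 0 < a) (hf : IntegrableOn f (square a))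
    (k : ℤ × ℤ) : squareFourierCoeff a f k = ∫ x in square a, f x * squareChar a k x := by
  have hint := integrableOn_mul_squareChar hf k
  rw [IntegrableOn, square, Measure.volume_eq_prod, ← Measure.prod_restrict] at hint
  rw [square, Measure.volume_eq_prod, ← Measure.prod_restrict, integral_prod_symm _ hint]
  simp only [squareFourierCoeff, intervalIntegral.integral_of_le (neg_le_self ha.le),
    integral_Icc_eq_integral_Ioc, squareChar]

theorem mFourier_neg_eq_squareChar (ha : 0 < a) (k : Fin 2 → ℤ) (y : UnitAddTorus (Fin 2)) :
    UnitAddTorus.mFourier (-k) y = squareChar a (k 0, k 1) (torusToSquare a y) := by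
  have hfourier : ∀ i, fourier (-k i) (y i) =
      Complex.exp (-(π * Complex.I * (a : ℂ)⁻¹ * (k i * circleToIoc a (y i)))) := by
    intro i
    have ha' : (a : ℂ) ≠ 0 := mod_cast ha.ne'
    conv_lhs => rw [← (AddCircle.equivIoc 1 (-(1 / 2))).symm_apply_apply (y i)]
    refine (fourier_coe_apply (T := 1)).trans ?_
    congr 1
    rw [circleToIoc]
    push_cast
    field_simp
  simp only [UnitAddTorus.mFourier, ContinuousMap.coe_mk, Fin.prod_univ_two, Pi.neg_apply]
  rw [hfourier, hfourier, ← Complex.exp_add, squareChar, torusToSquare, mul_add, neg_add]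

theorem measurePreserving_circleToIoc (ha : 0 < a) :
    MeasurePreserving (circleToIoc a) volume
      (ENNReal.ofReal (2 * a)⁻¹ • volume.restrict (Icc (-a) a)) := by
  have hscale : MeasurePreserving (2 * a * ·) volume (ENNReal.ofReal (2 * a)⁻¹ • volume) :=
    ⟨measurable_const_mul _, by
      rw [Real.map_volume_mul_left (by positivity), abs_of_pos (by positivity)]⟩
  have hpreimage : (2 * a * ·) ⁻¹' Ioc (-a) a = Ioc (-(1 / 2) : ℝ) (-(1 / 2) + 1) := by
    rw [preimage_const_mul_Ioc₀ _ _ (by positivity : 0 < 2 * a)]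
    rw [neg_div, div_mul_cancel_right₀ ha.ne']
    norm_num
  have hinterval := hscale.restrict_preimage (s := Ioc (-a) a) measurableSet_Ioc
  rw [hpreimage, Measure.restrict_smul, restrict_Ioc_eq_restrict_Icc (a := -a)] at hinterval
  refine hinterval.comp ((measurePreserving_subtype_coe measurableSet_Ioc).comp ?_)
  have hequiv := AddCircle.measurePreserving_equivIoc 1 (a := (-(1 / 2) : ℝ))
  rwa [AddCircle.volume_eq_smul_haarAddCircle, ENNReal.ofReal_one, one_smul] at hequiv

theorem measurePreserving_torusToSquare (ha : 0 < a) :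
    MeasurePreserving (torusToSquare a) volume
      (ENNReal.ofReal ((2 * a) ^ 2)⁻¹ • volume.restrict (square a)) := by
  have hprod := ((measurePreserving_circleToIoc ha).prod (measurePreserving_circleToIoc ha)).comp
    (volume_preserving_finTwoArrow UnitAddCircle)
  rwa [Measure.prod_smul_left, Measure.prod_smul_right, Measure.prod_restrict, smul_smul,
    ← ENNReal.ofReal_mul (by positivity), ← mul_inv, ← sq] at hprod

theorem integral_comp_torusToSquare (ha : 0 < a)
    (hf : AEStronglyMeasurable f (volume.restrict (square a))) :
    ∫ y, f (torusToSquare a y) = ((2 * a) ^ 2 : ℂ)⁻¹ * ∫ x in square a, f x := by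
  have hmap := measurePreserving_torusToSquare ha
  rw [← integral_map hmap.measurable.aemeasurable (by
    rw [hmap.map_eq]
    exact hf.mono_ac Measure.smul_absolutelyContinuous), hmap.map_eq, integral_smul_measure,
    ENNReal.toReal_ofReal (by positivity), Complex.real_smul]
  push_cast
  rfl

theorem memLp_comp_torusToSquare (ha : 0 < a) (hf : MemLp f 2 (volume.restrict (square a))) :
    MemLp (f ∘ torusToSquare a) 2 volume :=
  (hf.smul_measure ENNReal.ofReal_ne_top).comp_measurePreserving
    (measurePreserving_torusToSquare ha)

theorem mFourierCoeff_comp_torusToSquare (ha : 0 < a) (hf : IntegrableOn f (square a))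
    (k : Fin 2 → ℤ) :
    UnitAddTorus.mFourierCoeff (f ∘ torusToSquare a) k =
      ((2 * a) ^ 2 : ℂ)⁻¹ * squareFourierCoeff a f (k 0, k 1) := by
  rw [squareFourierCoeff_eq_setIntegral ha hf, ← integral_comp_torusToSquare ha
    (integrableOn_mul_squareChar hf _).aestronglyMeasurable, UnitAddTorus.mFourierCoeff]
  simp only [mFourier_neg_eq_squareChar ha, smul_eq_mul, Function.comp_apply, mul_comm]

theorem hasSum_conj_squareFourierCoeff_mul (ha : 0 < a)
    (hf : MemLp f 2 (volume.restrict (square a))) (hg : MemLp g 2 (volume.restrict (square a))) :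
    HasSum (fun k => conj (squareFourierCoeff a g k) * squareFourierCoeff a f k)
      ((2 * a) ^ 2 * ∫ x in square a, conj (g x) * f x) := by
  have hF := memLp_comp_torusToSquare ha hf
  have hG := memLp_comp_torusToSquare ha hg
  have hcoeff : ∀ {h : UnitAddTorus (Fin 2) → ℂ} (hh : MemLp h 2 volume) (k : Fin 2 → ℤ),
      UnitAddTorus.mFourierCoeff hh.toLp k = UnitAddTorus.mFourierCoeff h k := fun hh k =>
    integral_congr_ae (hh.coeFn_toLp.mono fun y hy => by simp only [hy])
  have hinner : ∫ y, conj ((hG.toLp : UnitAddTorus (Fin 2) → ℂ) y) *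
      (hF.toLp : UnitAddTorus (Fin 2) → ℂ) y =
      ((2 * a) ^ 2 : ℂ)⁻¹ * ∫ x in square a, conj (g x) * f x := by
    rw [← integral_comp_torusToSquare ha (f := fun x => conj (g x) * f x)
      ((Complex.continuous_conj.comp_aestronglyMeasurable hg.1).mul hf.1)]
    refine integral_congr_ae ?_
    filter_upwards [hF.coeFn_toLp, hG.coeFn_toLp] with y hFy hGy
    rw [hFy, hGy, Function.comp_apply, Function.comp_apply]
  have hparseval := (UnitAddTorus.hasSum_prod_mFourierCoeff hG.toLp hF.toLp).mul_left
    ((2 * a : ℂ) ^ 2 * (2 * a) ^ 2)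
  have ha' : (a : ℂ) ≠ 0 := mod_cast ha.ne'
  rw [hinner, mul_assoc, mul_inv_cancel_left₀ (by simp [ha']),
    ← (finTwoArrowEquiv ℤ).symm.hasSum_iff] at hparseval
  refine hparseval.congr_fun fun k => ?_
  simp only [Function.comp_apply, hcoeff,
    mFourierCoeff_comp_torusToSquare ha (hg.integrable one_le_two),
    mFourierCoeff_comp_torusToSquare ha (hf.integrable one_le_two), finTwoArrowEquiv_symm_apply,
    Matrix.cons_val_zero, Matrix.cons_val_one, map_mul, map_inv₀, map_pow, Complex.conj_ofReal,
    Complex.conj_ofNat]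
  field_simp

end Parseval

section ZernikeFourier

open scoped ComplexConjugate

theorem rho_eq_norm (k : ℤ × ℤ) : rho k = ‖(k.1 : ℂ) + k.2 * Complex.I‖ := by
  simpa only [rho, Complex.ofReal_intCast] using (Complex.norm_add_mul_I k.1 k.2).symm

theorem rho_mul_cos_phi (k : ℤ × ℤ) : rho k * cos (phi k) = k.1 := by
  rw [rho_eq_norm, phi, toIcoMod, zsmul_eq_mul, cos_sub_int_mul_two_pi, Complex.norm_mul_cos_arg]
  simp

theorem rho_mul_sin_phi (k : ℤ × ℤ) : rho k * sin (phi k) = k.2 := by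
  rw [rho_eq_norm, phi, toIcoMod, zsmul_eq_mul, sin_sub_int_mul_two_pi, Complex.norm_mul_sin_arg]
  simp

theorem conj_squareChar_polar (a : ℝ) (k : ℤ × ℤ) (r θ : ℝ) :
    conj (squareChar a k (r * cos θ, r * sin θ)) =
      Complex.exp (Complex.I * (π * rho k * (a⁻¹ * r) : ℝ) * cos (θ - phi k)) := by
  rw [squareChar, ← Complex.exp_conj, ← Complex.ofReal_intCast k.1, ← Complex.ofReal_intCast k.2,
    ← rho_mul_cos_phi, ← rho_mul_sin_phi, cos_sub]
  simp only [map_neg, map_mul, map_add, map_inv₀, Complex.conj_ofReal, Complex.conj_I]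
  push_cast
  ring_nf

theorem conj_zernikeV (a : ℝ) (n : ℕ) (m : ℤ) (r θ : ℝ) :
    conj (zernikeV a n m r θ) =
      (a⁻¹ * √((n + 1) / π) * zernikeRadial n m (a⁻¹ * r) : ℝ) *
        Complex.exp (-(Complex.I * m * θ)) := by
  rw [zernikeV, map_mul, Complex.conj_ofReal, ← Complex.exp_conj]
  simp only [map_mul, Complex.conj_I, Complex.conj_ofReal, map_intCast, neg_mul]

theorem I_zpow_mul_neg_one_zpow {n M : ℕ} {m : ℤ} (hn : n = m.natAbs + 2 * M) :
    Complex.I ^ m * (-1 : ℂ) ^ (((n : ℤ) - m) / 2) = Complex.I ^ m.natAbs * (-1) ^ M := by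
  have hI : (-1 : ℂ) = Complex.I ^ (2 : ℤ) := by simp
  rw [hI, ← zpow_mul, ← zpow_add₀ Complex.I_ne_zero, ← zpow_natCast, ← zpow_natCast, ← zpow_mul,
    ← zpow_add₀ Complex.I_ne_zero]
  congr 1
  omega

theorem zernikeCoeff_eq_setIntegral {a : ℝ} (ha : 0 ≤ a) (n : ℕ) (m : ℤ) {f : ℝ × ℝ → ℂ}
    (hf : IntegrableOn f (square a)) :
    zernikeCoeff a n m f = ∫ x in square a, conj (zernikeDisk a n m x) * f x := by
  obtain ⟨C, hC⟩ := exists_norm_zernikeDisk_le a n m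
  have hint : IntegrableOn (fun x => conj (zernikeDisk a n m x) * f x) (square a) :=
    hf.bdd_mul (Complex.continuous_conj.measurable.comp
      (measurable_zernikeDisk a n m)).aestronglyMeasurable
      (.of_forall fun x => (RCLike.norm_conj _).trans_le (hC x))
  have hzero : ∀ x ∈ square a \ disk a, conj (zernikeDisk a n m x) * f x = 0 := fun x hx => by
    rw [zernikeDisk, indicator_of_notMem hx.2, map_zero, zero_mul]
  rw [setIntegral_eq_of_subset_of_forall_sdiff_eq_zero (measurableSet_square a)
    (disk_subset_square a) hzero,
    setIntegral_disk_eq_integral_polar ha (hint.mono_set (disk_subset_square a)), zernikeCoeff,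
    intervalIntegral.integral_of_le ha, intervalIntegral.integral_of_le ha]
  refine setIntegral_congr_fun measurableSet_Ioc fun r hr =>
    intervalIntegral.integral_congr fun θ _ => ?_
  rw [zernikeDisk_polar hr.1 hr.2, Complex.real_smul]
  ring

theorem conj_squareFourierCoeff_zernikeDisk_eq_zernikeCoeff {a : ℝ} (ha : 0 < a) (n : ℕ) (m : ℤ)
    (k : ℤ × ℤ) :
    conj (squareFourierCoeff a (zernikeDisk a n m) k) =
      zernikeCoeff a n m fun x => conj (squareChar a k x) := by
  have hchar : IntegrableOn (fun x => conj (squareChar a k x)) (square a) :=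
    (Complex.continuous_conj.comp (continuous_squareChar a k)).continuousOn.integrableOn_compact
      (isCompact_square a)
  rw [squareFourierCoeff_eq_setIntegral ha ((memLp_zernikeDisk a n m 1).integrable le_rfl),
    ← integral_conj, zernikeCoeff_eq_setIntegral ha.le n m hchar]
  simp only [map_mul]

theorem zernikeCoeff_conj_squareChar {a : ℝ} (ha : a ≠ 0) {n M : ℕ} {m : ℤ}
    (hn : n = m.natAbs + 2 * M) (k : ℤ × ℤ) :
    zernikeCoeff a n m (fun x => conj (squareChar a k x)) =
      2 * a * √((n + 1) / π) * (Complex.I ^ m.natAbs * (-1) ^ M) * besselQuotient n (rho k) *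
        Complex.exp (-(Complex.I * m * phi k)) := by
  set c : ℂ := √((n + 1) / π) * (2 * π * Complex.I ^ m.natAbs) *
    Complex.exp (-(Complex.I * m * phi k)) with hc
  set F : ℝ → ℝ := fun u => zernikeRadial n m u * besselJ m.natAbs (π * rho k * u) * u with hF
  have hangular : ∀ r : ℝ, ∫ θ in (0 : ℝ)..(2 * π), conj (squareChar a k (r * cos θ, r * sin θ)) *
      conj (zernikeV a n m r θ) * r = c * F (a⁻¹ * r) := by
    intro r
    simp only [conj_squareChar_polar, conj_zernikeV]
    calc _ = ∫ θ in (0 : ℝ)..(2 * π),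
          (a⁻¹ * √((n + 1) / π) * zernikeRadial n m (a⁻¹ * r) * r : ℝ) *
          (Complex.exp (Complex.I * (π * rho k * (a⁻¹ * r) : ℝ) * cos (θ - phi k)) *
            Complex.exp (-(Complex.I * m * θ))) := by
          congr 1 with θ
          push_cast
          ring
      _ = c * F (a⁻¹ * r) := by
          rw [intervalIntegral.integral_const_mul, integral_exp_I_mul_cos_sub_eq_besselJ, hc, hF]
          push_cast
          ring
  have hπ : (π : ℂ) ≠ 0 := mod_cast pi_ne_zero
  simp only [zernikeCoeff, hangular]
  rw [intervalIntegral.integral_const_mul, intervalIntegral.integral_ofReal,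
    intervalIntegral.integral_comp_mul_left F (inv_ne_zero ha), mul_zero, inv_mul_cancel₀ ha,
    inv_inv, hF, integral_zernikeRadial_mul_besselJ hn, hc, smul_eq_mul]
  push_cast
  field_simp

theorem conj_squareFourierCoeff_zernikeDisk {a : ℝ} (ha : 0 < a) {n M : ℕ} {m : ℤ}
    (hn : n = m.natAbs + 2 * M) (k : ℤ × ℤ) :
    conj (squareFourierCoeff a (zernikeDisk a n m) k) = (2 * a) ^ 2 * zernikeKernel a k n m := by
  have hπ : ((√π : ℝ) : ℂ) ≠ 0 := mod_cast (sqrt_pos.2 pi_pos).ne'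
  have ha' : (a : ℂ) ≠ 0 := mod_cast ha.ne'
  rw [conj_squareFourierCoeff_zernikeDisk_eq_zernikeCoeff ha,
    zernikeCoeff_conj_squareChar ha.ne' hn, zernikeKernel, I_zpow_mul_neg_one_zpow hn,
    sqrt_div (by positivity)]
  push_cast
  field_simp

end ZernikeFourier

end FourierZernike

theorem mainTheorem2_general (a : ℝ) (ha : 0 < a) (f : ℝ × ℝ → ℂ)
    (hf : MeasureTheory.MemLp f 2
      (MeasureTheory.volume.restrict (FourierZernike.square a)))
    (m : ℤ) (n : ℕ) (hmn : |m| ≤ (n : ℤ)) (hpar : (n : ℤ) ≡ |m| [ZMOD 2]) :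
    HasSum
      (fun k : ℤ × ℤ =>
        FourierZernike.zernikeKernel a k n m * FourierZernike.squareFourierCoeff a f k)
      (FourierZernike.zernikeCoeff a n m f) := by
  obtain ⟨M, hn⟩ : ∃ M : ℕ, n = m.natAbs + 2 * M := by
    rw [Int.ModEq] at hpar
    rw [Int.abs_eq_natAbs] at hmn hpar
    exact ⟨(n - m.natAbs) / 2, by omega⟩
  have hparseval := FourierZernike.hasSum_conj_squareFourierCoeff_mul ha hf
    (FourierZernike.memLp_zernikeDisk a n m 2)
  simp only [FourierZernike.conj_squareFourierCoeff_zernikeDisk ha hn, mul_assoc] at hparseval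
  rw [← FourierZernike.zernikeCoeff_eq_setIntegral ha.le n m (hf.integrable one_le_two)]
    at hparseval
  have ha' : (2 * a : ℂ) ^ 2 ≠ 0 := by simp [ha.ne']
  exact (hasSum_mul_left_iff ha').1 hparseval

theorem mainTheorem2 (a : ℝ) (ha : 0 < a) (f : ℝ × ℝ → ℂ)
    (hf : MeasureTheory.MemLp f 2
      (MeasureTheory.volume.restrict (FourierZernike.square a)))
    (hsupp : ∀ᵐ x ∂(MeasureTheory.volume.restrict (FourierZernike.square a)),
      x ∉ FourierZernike.disk a → f x = 0)
    (m : ℤ) (n : ℕ) (hmn : |m| ≤ (n : ℤ)) (hpar : (n : ℤ) ≡ |m| [ZMOD 2]) :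
    HasSum
      (fun k : ℤ × ℤ =>
        FourierZernike.zernikeKernel a k n m * FourierZernike.squareFourierCoeff a f k)
      (FourierZernike.zernikeCoeff a n m f) :=
  mainTheorem2_general a ha f hf m n hmn hpar
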